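/- Let $X_1,X_2,\dots$ be nonnegative, identically distributed random variables with distribution function $F(x)=P(X_1\le x)$ satisfying $F(0)<1$ and with mean $\mu=E X_1\in(0,\infty]$. Suppose the sequence is sub-independent, that is, for every $n\ge 1$ the characteristic function of $S_n=X_1+\cdots+X_n$ is the product of the characteristic functions of $X_1,\dots,X_n$. Put $S_0=0$, $N(t)=\sup\{n\ge 0: S_n\le t\}$ and $U(t)=E\,N(t)$ for $t\ge 0$, and let $F^{*n}$ be the $n$-fold convolution of $F$ with itself. Then, for every $t\ge 0$, $U(t)<\infty$, $$U(t)=\sum_{n=1}^{\infty}F^{*n}(t),\qquad U(t)=F(t)+(U*F)(t),\quad\text{where } (U*F)(t)=\int_{[0,t]}U(t-x)\,dF(x),$$ and $$\lim_{t\to\infty}\frac{U(t)}{t}=\begin{cases}1/\mu,&\mu<\infty,\\ 0,&\mu=\infty.\end{cases}$$ If, in addition, $0<\sigma^2=\operatorname{Var}(X_1)<\infty$, then $$\frac{N(t)-t/\mu}{\sigma\sqrt{t/\mu^{3}}}\ \longrightarrow\ N(0,1)\quad\text{in distribution as } t\to\infty.$$ -/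

import Mathlib

open MeasureTheory ProbabilityTheory Filter Topology
open scoped ENNReal

/-- The random variables `X i`, `i ∈ s`, are sub-independent under `P`: the characteristic function
of their sum is the product of their characteristic functions. -/
def SubIndependent {Ω ι : Type*} [MeasurableSpace Ω] (P : Measure Ω) (s : Finset ι)
    (X : ι → Ω → ℝ) : Prop :=
  ∀ u : ℝ, charFun (P.map fun ω => ∑ i ∈ s, X i ω) u = ∏ i ∈ s, charFun (P.map (X i)) u

/-- The `n`-fold convolution of a measure on `ℝ` with itself (`δ₀` for `n = 0`). -/
noncomputable def convPower (ν : Measure ℝ) : ℕ → Measure ℝ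
  | 0 => Measure.dirac 0
  | n + 1 => (convPower ν n).conv ν

/-- The partial sum `S_n` of the first `n` variables. The variable usually called `X_{i+1}` is
`X i`. -/
def partialSum {Ω : Type*} (X : ℕ → Ω → ℝ) (n : ℕ) (ω : Ω) : ℝ :=
  ∑ i ∈ Finset.range n, X i ω

/-- The renewal counting process `N(t) = sup {n ≥ 0 : S_n ≤ t}`, with values in `{0, 1, …, ∞}`. -/
noncomputable def renewalCount {Ω : Type*} (X : ℕ → Ω → ℝ) (t : ℝ) (ω : Ω) : ℕ∞ :=
  sSup ((fun n : ℕ => (n : ℕ∞)) '' {n : ℕ | partialSum X n ω ≤ t})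

/-- The renewal function `U(t) = E N(t)`, a Lebesgue integral with values in `[0, ∞]`. -/
noncomputable def renewalFunction {Ω : Type*} [MeasurableSpace Ω] (P : Measure Ω)
    (X : ℕ → Ω → ℝ) (t : ℝ) : ℝ≥0∞ :=
  ∫⁻ ω, (renewalCount X t ω : ℝ≥0∞) ∂P

/-- The convolution `(U * F)(t) = ∫_{[0,t]} U(t - x) dF(x)` of a nonnegative function `U` on
`[0, ∞)` with the distribution `ν` (having distribution function `F`) of a nonnegative random
variable. An atom of `ν` at `0` is included. -/
noncomputable def stieltjesConv (U : ℝ → ℝ≥0∞) (ν : Measure ℝ) (t : ℝ) : ℝ≥0∞ :=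
  ∫⁻ x in Set.Icc 0 t, U (t - x) ∂ν

/-! Sub-independence gives `S_n` the characteristic function `φ^n`, hence the law `F^{*n}`, just as
under independence. As the summands are nonnegative, `{N(t) ≥ n} = {S_n ≤ t}` almost surely for `t ≥
0`, so each claim only involves the laws of single sums.

Summing over `n` gives the series for `U` (`renewalFunction_eq_renewalSum`). It converges because
`F^{*n}(t) ≤ e^t L^n`, where `L = E e^{-X} < 1`. In place of Wald's identity, the limit of `U(t)/t`
rests on `∑_k ∫ g(t - x) dF^{*k}(x) = t` with `g(y) = E min(X, y)` (`tsum_lintegral_truncatedMean`),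
which bounds `U` on both sides.

For the normal limit, Lévy's continuity theorem handles `S_n`; Slutsky's lemma along `n(t) = ⌈t/m +
c√t⌉`, where `m` is the mean, carries the limit over to `N(t)`. -/

/-! ### Convolution powers and the renewal series. -/

section ConvPower

variable {ν : Measure ℝ}

instance isProbabilityMeasure_convPower [IsProbabilityMeasure ν] (n : ℕ) :
    IsProbabilityMeasure (convPower ν n) := by
  induction n with
  | zero => exact Measure.dirac.isProbabilityMeasure
  | succ n ih => exact Measure.probabilitymeasure_of_probabilitymeasures_conv _ _

lemma convPower_one [SFinite ν] : convPower ν 1 = ν := by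
  simp [convPower]

lemma charFun_convPower [IsProbabilityMeasure ν] (n : ℕ) (u : ℝ) :
    charFun (convPower ν n) u = charFun ν u ^ n := by
  induction n with
  | zero => simp [convPower, charFun_dirac]
  | succ n ih => rw [convPower, charFun_conv, ih, pow_succ]

lemma lintegral_convPower_succ [IsProbabilityMeasure ν] (n : ℕ) {f : ℝ → ℝ≥0∞}
    (hf : Measurable f) :
    ∫⁻ z, f z ∂(convPower ν (n + 1)) = ∫⁻ x, ∫⁻ y, f (x + y) ∂ν ∂(convPower ν n) := by
  rw [convPower, Measure.lintegral_conv hf]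

lemma convPower_succ_Iic [IsProbabilityMeasure ν] (n : ℕ) (t : ℝ) :
    convPower ν (n + 1) (Set.Iic t) = ∫⁻ x, convPower ν n (Set.Iic (t - x)) ∂ν := by
  rw [convPower, Measure.conv_comm, ← lintegral_indicator_one measurableSet_Iic,
    Measure.lintegral_conv (measurable_one.indicator measurableSet_Iic)]
  congr with x
  rw [← lintegral_indicator_one measurableSet_Iic]
  congr with y
  simp only [Set.indicator, Set.mem_Iic, le_sub_iff_add_le', Pi.one_apply]

lemma ae_nonneg_convPower [IsProbabilityMeasure ν] (h : ∀ᵐ x ∂ν, 0 ≤ x) (n : ℕ) :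
    ∀ᵐ x ∂(convPower ν n), 0 ≤ x := by
  induction n with
  | zero => simp [convPower, ae_dirac_eq]
  | succ n ih =>
    have hm : MeasurableSet {a : ℝ | ¬0 ≤ a} := by
      simp only [not_le]
      exact measurableSet_Iio
    rw [ae_iff, ← lintegral_indicator_one hm,
      lintegral_convPower_succ n (measurable_one.indicator hm)]
    refine lintegral_eq_zero_of_ae_eq_zero ?_
    filter_upwards [ih] with x hx
    refine lintegral_eq_zero_of_ae_eq_zero ?_
    filter_upwards [h] with y hy
    simp [add_nonneg hx hy]

lemma convPower_Iic_of_neg [IsProbabilityMeasure ν] (h : ∀ᵐ x ∂ν, 0 ≤ x) (n : ℕ) {t : ℝ}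
    (ht : t < 0) : convPower ν n (Set.Iic t) = 0 := by
  refine measure_mono_null (fun x hx => ?_) (ae_iff.1 (ae_nonneg_convPower h n))
  simpa using lt_of_le_of_lt hx ht

/-- The renewal function `∑_{k ≥ 1} ν^{*k}((-∞, t])` of a distribution `ν`. -/
noncomputable def renewalSum (ν : Measure ℝ) (t : ℝ) : ℝ≥0∞ :=
  ∑' k : ℕ, convPower ν (k + 1) (Set.Iic t)

lemma one_add_renewalSum {t : ℝ} (ht : 0 ≤ t) :
    1 + renewalSum ν t = ∑' k : ℕ, convPower ν k (Set.Iic t) := by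
  rw [tsum_eq_zero_add' ENNReal.summable, renewalSum]
  simp [convPower, ht]

lemma lintegral_exp_neg_convPower [IsProbabilityMeasure ν] (n : ℕ) :
    ∫⁻ x, ENNReal.ofReal (Real.exp (-x)) ∂(convPower ν n) =
      (∫⁻ x, ENNReal.ofReal (Real.exp (-x)) ∂ν) ^ n := by
  induction n with
  | zero => simp [convPower]
  | succ n ih =>
    rw [lintegral_convPower_succ n (by fun_prop), pow_succ, ← ih,
      ← lintegral_mul_const _ (by fun_prop)]
    congr with x
    rw [← lintegral_const_mul _ (by fun_prop)]
    congr with y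
    rw [neg_add, Real.exp_add, ENNReal.ofReal_mul (Real.exp_nonneg _)]

lemma lintegral_exp_neg_lt_one [IsProbabilityMeasure ν] (h : ∀ᵐ x ∂ν, 0 ≤ x)
    (h0 : ν (Set.Ioi 0) ≠ 0) : ∫⁻ x, ENNReal.ofReal (Real.exp (-x)) ∂ν < 1 := by
  have hle : ∀ᵐ x ∂ν, ENNReal.ofReal (Real.exp (-x)) ≤ 1 := by
    filter_upwards [h] with x hx
    simpa using hx
  have h1 : ∫⁻ _, (1 : ℝ≥0∞) ∂ν = 1 := by simp
  rw [← h1]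
  have hfin : ∫⁻ x, ENNReal.ofReal (Real.exp (-x)) ∂ν ≠ ⊤ :=
    ((lintegral_mono_ae hle).trans_lt (by simp)).ne
  refine lintegral_strict_mono_of_ae_le_of_ae_lt_on (by fun_prop) hfin hle h0 (ae_of_all _ ?_)
  intro x hx
  simpa [ENNReal.ofReal_lt_one] using hx

/-- Chernoff bound: the indicator of `x ≤ t` is at most `e^{t - x}`. -/
lemma convPower_Iic_le_pow [IsProbabilityMeasure ν] (n : ℕ) (t : ℝ) :
    convPower ν n (Set.Iic t) ≤
      ENNReal.ofReal (Real.exp t) * (∫⁻ x, ENNReal.ofReal (Real.exp (-x)) ∂ν) ^ n := by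
  rw [← lintegral_exp_neg_convPower, ← lintegral_const_mul _ (by fun_prop),
    ← lintegral_indicator_one measurableSet_Iic]
  refine lintegral_mono fun x => ?_
  by_cases hx : x ≤ t
  · simp [hx, ← ENNReal.ofReal_mul (Real.exp_nonneg _), ← Real.exp_add]
  · simp [hx]

lemma tsum_convPower_Iic_ne_top [IsProbabilityMeasure ν] (h : ∀ᵐ x ∂ν, 0 ≤ x)
    (h0 : ν (Set.Ioi 0) ≠ 0) (t : ℝ) : ∑' k : ℕ, convPower ν k (Set.Iic t) ≠ ⊤ := by
  refine ne_top_of_le_ne_top ?_ (ENNReal.tsum_le_tsum fun k => convPower_Iic_le_pow k t)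
  rw [ENNReal.tsum_mul_left, ENNReal.tsum_geometric]
  refine ENNReal.mul_ne_top ENNReal.ofReal_ne_top (ENNReal.inv_ne_top.2 ?_)
  exact (tsub_pos_iff_lt.2 (lintegral_exp_neg_lt_one h h0)).ne'

lemma renewalSum_ne_top [IsProbabilityMeasure ν] (h : ∀ᵐ x ∂ν, 0 ≤ x)
    (h0 : ν (Set.Ioi 0) ≠ 0) {t : ℝ} (ht : 0 ≤ t) : renewalSum ν t ≠ ⊤ := by
  have hle : renewalSum ν t ≤ 1 + renewalSum ν t := le_add_self
  exact ne_top_of_le_ne_top (tsum_convPower_Iic_ne_top h h0 t)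
    (hle.trans_eq (one_add_renewalSum ht))

lemma measurable_convPower_Iic_sub [IsProbabilityMeasure ν] (n : ℕ) (t : ℝ) :
    Measurable fun x => convPower ν n (Set.Iic (t - x)) :=
  Antitone.measurable fun _ _ hxy => measure_mono (Set.Iic_subset_Iic.2 (by linarith))

/-- The renewal equation. -/
lemma renewalSum_eq_add_stieltjesConv [IsProbabilityMeasure ν] (h : ∀ᵐ x ∂ν, 0 ≤ x) (t : ℝ) :
    renewalSum ν t = ν (Set.Iic t) + stieltjesConv (renewalSum ν) ν t := by
  rw [renewalSum, tsum_eq_zero_add' ENNReal.summable, zero_add, convPower_one, stieltjesConv]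
  congr 1
  simp only [renewalSum]
  rw [lintegral_tsum fun k => (measurable_convPower_Iic_sub _ _).aemeasurable]
  refine tsum_congr fun k => ?_
  rw [convPower_succ_Iic, ← lintegral_indicator measurableSet_Icc]
  refine lintegral_congr_ae ?_
  filter_upwards [h] with x hx
  -- For `x > t` the integrand vanishes, so the integral may be cut down to `[0, t]`.
  by_cases hxt : x ≤ t
  · simp [hx, hxt]
  · simp [hxt, convPower_Iic_of_neg h (k + 1) (t := t - x) (by linarith)]

/-! ### Truncated means and the elementary renewal theorem. -/

/-- The truncated mean `∫ min(x, y) dν(x)` of a distribution on `[0, ∞)`. -/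
noncomputable def truncatedMean (ν : Measure ℝ) (y : ℝ) : ℝ≥0∞ :=
  ∫⁻ x, ENNReal.ofReal (min x y) ∂ν

lemma truncatedMean_mono : Monotone (truncatedMean ν) := fun _ _ h =>
  lintegral_mono fun _ => ENNReal.ofReal_le_ofReal (min_le_min_left _ h)

lemma truncatedMean_of_nonpos {y : ℝ} (hy : y ≤ 0) : truncatedMean ν y = 0 := by
  simp [truncatedMean, ENNReal.ofReal_of_nonpos (min_le_of_right_le hy)]

lemma truncatedMean_le (y : ℝ) : truncatedMean ν y ≤ ∫⁻ x, ENNReal.ofReal x ∂ν :=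
  lintegral_mono fun _ => ENNReal.ofReal_le_ofReal (min_le_left _ _)

lemma truncatedMean_ne_top [IsProbabilityMeasure ν] (y : ℝ) : truncatedMean ν y ≠ ⊤ := by
  refine ne_top_of_le_ne_top ?_
    (lintegral_mono fun x => ENNReal.ofReal_le_ofReal (min_le_right x y))
  simp

lemma tendsto_truncatedMean :
    Tendsto (fun n : ℕ => truncatedMean ν n) atTop (𝓝 (∫⁻ x, ENNReal.ofReal x ∂ν)) := by
  refine lintegral_tendsto_of_tendsto_of_monotone (fun n => by fun_prop) (ae_of_all _ ?_)
    (ae_of_all _ fun x => ?_)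
  · intro x m n hmn
    exact ENNReal.ofReal_le_ofReal (min_le_min_left _ (by exact_mod_cast hmn))
  · refine tendsto_const_nhds.congr' ?_
    filter_upwards [eventually_ge_atTop ⌈x⌉₊] with n hn
    rw [min_eq_left (Nat.ceil_le.1 hn)]

/-- For `y ≥ 0`, `(s)⁺ = (s - y)⁺ + min(y, s)⁺` with `s = t - x`; integrate in `y`, then in `x`. -/
lemma lintegral_ofReal_sub_convPower [IsProbabilityMeasure ν] (h : ∀ᵐ x ∂ν, 0 ≤ x) (n : ℕ)
    (t : ℝ) :
    ∫⁻ x, ENNReal.ofReal (t - x) ∂(convPower ν n) =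
      ∫⁻ x, ENNReal.ofReal (t - x) ∂(convPower ν (n + 1)) +
        ∫⁻ x, truncatedMean ν (t - x) ∂(convPower ν n) := by
  rw [lintegral_convPower_succ n (by fun_prop), ← lintegral_add_left (by fun_prop)]
  congr with x
  rw [truncatedMean, ← lintegral_add_left (by fun_prop)]
  have : ENNReal.ofReal (t - x) = ∫⁻ _, ENNReal.ofReal (t - x) ∂ν := by simp
  rw [this]
  refine lintegral_congr_ae ?_
  filter_upwards [h] with y hy
  rcases le_total 0 (t - x) with h1 | h1
  · rcases le_total y (t - x) with h2 | h2
    · rw [min_eq_left h2, ← ENNReal.ofReal_add (by linarith) hy]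
      ring_nf
    · rw [min_eq_right h2, ENNReal.ofReal_of_nonpos (p := t - (x + y)) (by linarith), zero_add]
  · rw [ENNReal.ofReal_of_nonpos h1, ENNReal.ofReal_of_nonpos (by linarith),
      ENNReal.ofReal_of_nonpos (min_le_of_right_le h1), zero_add]

/-- The renewal measure integrates the truncated mean to `t`. -/
lemma tsum_lintegral_truncatedMean [IsProbabilityMeasure ν] (h : ∀ᵐ x ∂ν, 0 ≤ x)
    (h0 : ν (Set.Ioi 0) ≠ 0) (t : ℝ) :
    ∑' k : ℕ, ∫⁻ x, truncatedMean ν (t - x) ∂(convPower ν k) = ENNReal.ofReal t := by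
  -- Telescoping leaves the remainder `E (t - S_n)⁺ ≤ t F^{*n}(t)`, which tends to `0` because the
  -- series converges.
  have hsum (n : ℕ) : ENNReal.ofReal t = ∫⁻ x, ENNReal.ofReal (t - x) ∂(convPower ν n) +
      ∑ k ∈ Finset.range n, ∫⁻ x, truncatedMean ν (t - x) ∂(convPower ν k) := by
    induction n with
    | zero => simp [convPower]
    | succ n ih =>
      rw [ih, lintegral_ofReal_sub_convPower h n, Finset.sum_range_succ]
      ring
  have hle (n : ℕ) : ∫⁻ x, ENNReal.ofReal (t - x) ∂(convPower ν n) ≤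
      ENNReal.ofReal t * convPower ν n (Set.Iic t) := by
    rw [← lintegral_indicator_one measurableSet_Iic, ← lintegral_const_mul _ (by measurability)]
    refine lintegral_mono_ae ?_
    filter_upwards [ae_nonneg_convPower h n] with x hx
    by_cases hxt : x ≤ t
    · simpa [hxt] using ENNReal.ofReal_le_ofReal (by linarith : t - x ≤ t)
    · simp [hxt, ENNReal.ofReal_of_nonpos (by linarith : t - x ≤ 0)]
  have hz : Tendsto (fun n => ∫⁻ x, ENNReal.ofReal (t - x) ∂(convPower ν n)) atTop (𝓝 0) := by
    refine tendsto_of_tendsto_of_tendsto_of_le_of_le tendsto_const_nhds ?_ (fun _ => zero_le)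
      hle
    have := ENNReal.Tendsto.const_mul (a := ENNReal.ofReal t)
      (ENNReal.tendsto_atTop_zero_of_tsum_ne_top (tsum_convPower_Iic_ne_top h h0 t))
      (Or.inr ENNReal.ofReal_ne_top)
    simpa using this
  have h2 := hz.add (ENNReal.summable (f := fun k =>
    ∫⁻ x, truncatedMean ν (t - x) ∂(convPower ν k))).hasSum.tendsto_sum_nat
  simp_rw [← hsum, zero_add] at h2
  exact tendsto_nhds_unique h2 tendsto_const_nhds

/-- In the identity at level `t`, the truncated mean is at most `μ`, and it vanishes for `x > t`. -/
lemma ofReal_le_mean_mul_one_add_renewalSum [IsProbabilityMeasure ν] (h : ∀ᵐ x ∂ν, 0 ≤ x)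
    (h0 : ν (Set.Ioi 0) ≠ 0) {t : ℝ} (ht : 0 ≤ t) :
    ENNReal.ofReal t ≤ (∫⁻ x, ENNReal.ofReal x ∂ν) * (1 + renewalSum ν t) := by
  rw [one_add_renewalSum ht, ← tsum_lintegral_truncatedMean h h0, ← ENNReal.tsum_mul_left]
  refine ENNReal.tsum_le_tsum fun k => ?_
  rw [← lintegral_indicator_one measurableSet_Iic, ← lintegral_const_mul _ (by measurability)]
  refine lintegral_mono fun x => ?_
  by_cases hxt : x ≤ t
  · simpa [hxt] using truncatedMean_le _
  · simp [hxt, truncatedMean_of_nonpos (by linarith : t - x ≤ 0)]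

/-- Use the identity at level `t + a` and keep only `x ≤ t`, where `t + a - x ≥ a`. -/
lemma truncatedMean_mul_one_add_renewalSum_le [IsProbabilityMeasure ν] (h : ∀ᵐ x ∂ν, 0 ≤ x)
    (h0 : ν (Set.Ioi 0) ≠ 0) (a : ℝ) {t : ℝ} (ht : 0 ≤ t) :
    truncatedMean ν a * (1 + renewalSum ν t) ≤ ENNReal.ofReal (t + a) := by
  rw [one_add_renewalSum ht, ← tsum_lintegral_truncatedMean h h0, ← ENNReal.tsum_mul_left]
  refine ENNReal.tsum_le_tsum fun k => ?_
  rw [← lintegral_indicator_one measurableSet_Iic, ← lintegral_const_mul _ (by measurability)]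
  refine lintegral_mono fun x => ?_
  by_cases hxt : x ≤ t
  · simpa [hxt] using truncatedMean_mono (by linarith)
  · simp [hxt]

/-- The elementary renewal theorem. -/
lemma tendsto_renewalSum_div [IsProbabilityMeasure ν] (h : ∀ᵐ x ∂ν, 0 ≤ x)
    (h0 : ν (Set.Ioi 0) ≠ 0) :
    Tendsto (fun t => (renewalSum ν t).toReal / t) atTop
      (𝓝 (∫⁻ x, ENNReal.ofReal x ∂ν)⁻¹.toReal) := by
  set μ := ∫⁻ x, ENNReal.ofReal x ∂ν with hμ
  have hμ0 : μ ≠ 0 := by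
    intro hz
    rw [hμ, lintegral_eq_zero_iff (by fun_prop)] at hz
    refine h0 (measure_mono_null (fun x hx => ?_) (ae_iff.1 hz))
    simpa using hx
  have hdiv (c : ℝ) : Tendsto (fun t : ℝ => c / t) atTop (𝓝 0) :=
    tendsto_const_nhds.div_atTop tendsto_id
  refine tendsto_order.2 ⟨fun c hc => ?_, fun c hc => ?_⟩
  · by_cases hμt : μ = ⊤
    · filter_upwards [eventually_gt_atTop 0] with t ht
      refine hc.trans_le ?_
      simp only [hμt, ENNReal.inv_top, ENNReal.toReal_zero]
      positivity
    · have hlim : Tendsto (fun t : ℝ => μ.toReal⁻¹ - 1 / t) atTop (𝓝 μ.toReal⁻¹) := by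
        simpa using (hdiv 1).const_sub μ.toReal⁻¹
      rw [ENNReal.toReal_inv] at hc
      have hpos : 0 < μ.toReal := ENNReal.toReal_pos hμ0 hμt
      filter_upwards [hlim.eventually_const_lt hc, eventually_gt_atTop 0] with t hct ht
      refine hct.trans_le ?_
      have hU := renewalSum_ne_top h h0 ht.le
      have := ENNReal.toReal_mono (by finiteness)
        (ofReal_le_mean_mul_one_add_renewalSum h h0 ht.le)
      rw [ENNReal.toReal_ofReal ht.le, ENNReal.toReal_mul, ENNReal.toReal_add (by simp) hU,
        ENNReal.toReal_one] at this
      rw [le_div_iff₀ ht, sub_mul, one_div, inv_mul_cancel₀ ht.ne', sub_le_iff_le_add',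
        inv_mul_le_iff₀ hpos]
      exact this
  · have hc0 : 0 < c := ENNReal.toReal_nonneg.trans_lt hc
    -- Truncated means increase to `μ > 1/c`, also when `μ = ∞`.
    obtain ⟨a, ha⟩ : ∃ a : ℕ, ENNReal.ofReal c⁻¹ < truncatedMean ν a := by
      refine (tendsto_truncatedMean.eventually_const_lt ?_).exists
      rw [ENNReal.ofReal_inv_of_pos hc0]
      refine ENNReal.inv_lt_iff_inv_lt.1 ?_
      rw [← ENNReal.ofReal_toReal (ENNReal.inv_ne_top.2 hμ0)]
      exact (ENNReal.ofReal_lt_ofReal_iff hc0).2 hc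
    have hga : c⁻¹ < (truncatedMean ν a).toReal :=
      (ENNReal.ofReal_lt_iff_lt_toReal (by positivity) (truncatedMean_ne_top _)).1 ha
    have hg0 : 0 < (truncatedMean ν a).toReal := (inv_pos.2 hc0).trans hga
    have hlim : Tendsto (fun t : ℝ => (1 + a / t) * (truncatedMean ν a).toReal⁻¹) atTop
        (𝓝 (truncatedMean ν a).toReal⁻¹) := by
      simpa using ((hdiv a).const_add 1).mul_const (truncatedMean ν a).toReal⁻¹
    filter_upwards [hlim.eventually_lt_const (inv_lt_of_inv_lt₀ hc0 hga), eventually_gt_atTop 0]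
      with t hct ht
    refine lt_of_le_of_lt ?_ hct
    have hU := renewalSum_ne_top h h0 ht.le
    have := ENNReal.toReal_mono ENNReal.ofReal_ne_top
      (truncatedMean_mul_one_add_renewalSum_le h h0 a ht.le)
    rw [ENNReal.toReal_ofReal (by positivity), ENNReal.toReal_mul,
      ENNReal.toReal_add (by simp) hU, ENNReal.toReal_one] at this
    rw [← div_eq_mul_inv, le_div_iff₀ hg0, div_mul_eq_mul_div, div_le_iff₀ ht, add_mul,
      div_mul_cancel₀ _ ht.ne']
    nlinarith

end ConvPower

/-! ### The counting process and its tail events. -/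

lemma measurable_partialSum {Ω : Type*} [MeasurableSpace Ω] {X : ℕ → Ω → ℝ}
    (hmeas : ∀ i, Measurable (X i)) (n : ℕ) : Measurable (partialSum X n) := by
  unfold partialSum
  fun_prop

lemma monotone_partialSum {Ω : Type*} {X : ℕ → Ω → ℝ} {ω : Ω} (h : ∀ i, 0 ≤ X i ω) :
    Monotone fun n => partialSum X n ω :=
  monotone_nat_of_le_succ fun n => by simpa [partialSum, Finset.sum_range_succ] using h n

lemma renewalCount_le_iff {Ω : Type*} {X : ℕ → Ω → ℝ} {t : ℝ} {ω : Ω} {m : ℕ} :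
    renewalCount X t ω ≤ m ↔ ∀ n, partialSum X n ω ≤ t → n ≤ m := by
  simp [renewalCount, sSup_le_iff]

/-- If `S_n > t`, monotonicity keeps all later sums above `t`. The case `n = 0` needs `t ≥ 0`. -/
lemma natCast_le_renewalCount_iff {Ω : Type*} {X : ℕ → Ω → ℝ} {t : ℝ} {ω : Ω}
    (h : Monotone fun n => partialSum X n ω) (ht : 0 ≤ t) (n : ℕ) :
    (n : ℕ∞) ≤ renewalCount X t ω ↔ partialSum X n ω ≤ t := by
  refine ⟨fun hn => ?_, fun hn => le_sSup ⟨n, hn, rfl⟩⟩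
  cases n with
  | zero => simpa [partialSum] using ht
  | succ n =>
    by_contra hlt
    have : renewalCount X t ω ≤ n := by
      rw [renewalCount_le_iff]
      intro k hk
      by_contra hkn
      exact hlt ((h (by omega : n + 1 ≤ k)).trans hk)
    have := hn.trans this
    rw [Nat.cast_le] at this
    omega

lemma measurable_renewalCount {Ω : Type*} [MeasurableSpace Ω] {X : ℕ → Ω → ℝ}
    (hmeas : ∀ i, Measurable (X i)) (t : ℝ) : Measurable (renewalCount X t) := by
  have hle (m : ℕ) : MeasurableSet {ω | renewalCount X t ω ≤ m} := by
    simp only [renewalCount_le_iff, Set.ofPred_forall]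
    refine MeasurableSet.iInter fun n => ?_
    by_cases hnm : n ≤ m
    · simp [hnm]
    · simpa [hnm] using measurableSet_lt measurable_const (measurable_partialSum hmeas n)
  refine measurable_to_countable' fun c => ?_
  induction c with
  | top =>
    have : renewalCount X t ⁻¹' {⊤} = ⋂ m : ℕ, {ω | renewalCount X t ω ≤ m}ᶜ := by
      ext ω
      simp [ENat.eq_top_iff_forall_gt]
    rw [this]
    exact MeasurableSet.iInter fun m => (hle m).compl
  | coe n =>
    cases n with
    | zero => simpa [Set.preimage] using hle 0
    | succ n =>
      have : renewalCount X t ⁻¹' {((n + 1 : ℕ) : ℕ∞)} =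
          {ω | renewalCount X t ω ≤ (n + 1 : ℕ)} \ {ω | renewalCount X t ω ≤ n} := by
        ext ω
        have := ENat.lt_add_one_iff (m := (n : ℕ∞)) (n := renewalCount X t ω)
        simp only [Set.mem_preimage, Set.mem_singleton_iff, Set.mem_sdiff, Set.mem_ofPred_eq, not_le]
        constructor
        · intro h
          rw [h]
          exact ⟨le_rfl, by exact_mod_cast Nat.lt_succ_self n⟩
        · rintro ⟨h1, h2⟩
          refine le_antisymm h1 ?_
          push_cast
          exact Order.add_one_le_of_lt h2
      rw [this]
      exact (hle _).diff (hle _)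

lemma ENat.toENNReal_eq_tsum_indicator (N : ℕ∞) :
    (N : ℝ≥0∞) = ∑' k : ℕ, {k : ℕ | ((k + 1 : ℕ) : ℕ∞) ≤ N}.indicator 1 k := by
  induction N with
  | top => simp
  | coe n =>
    have hmem (k : ℕ) : k ∈ {k : ℕ | ((k + 1 : ℕ) : ℕ∞) ≤ (n : ℕ∞)} ↔ k < n := by
      rw [Set.mem_ofPred_eq, Nat.cast_le, Nat.succ_le_iff]
    rw [tsum_eq_sum (s := Finset.range n), Finset.sum_congr rfl (g := fun _ => 1)]
    · simp
    · intro k hk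
      rw [Set.indicator_of_mem ((hmem k).2 (Finset.mem_range.1 hk)), Pi.one_apply]
    · intro k hk
      exact Set.indicator_of_notMem (fun h => hk (Finset.mem_range.2 ((hmem k).1 h))) _

/-- Since `toNat` sends `∞` to `0`, almost sure finiteness is needed; it follows from `U(t) < ∞`. -/
lemma measure_le_renewalCount {Ω : Type*} [MeasurableSpace Ω] {P : Measure Ω}
    {X : ℕ → Ω → ℝ} (hmeas : ∀ i, Measurable (X i))
    (hnonneg : ∀ i, ∀ᵐ ω ∂P, 0 ≤ X i ω) {t : ℝ} (ht : 0 ≤ t)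
    (hfin : renewalFunction P X t ≠ ⊤) (n : ℕ) :
    P {ω | n ≤ (renewalCount X t ω).toNat} = P {ω | partialSum X n ω ≤ t} := by
  have hm : Measurable fun ω => (renewalCount X t ω : ℝ≥0∞) :=
    measurable_from_top.comp (measurable_renewalCount hmeas t)
  refine measure_congr ?_
  filter_upwards [ae_all_iff.2 hnonneg, ae_lt_top hm hfin] with ω hω hωt
  rw [ENat.toENNReal_lt_top] at hωt
  refine propext ?_
  change n ≤ (renewalCount X t ω).toNat ↔ partialSum X n ω ≤ t
  rw [← natCast_le_renewalCount_iff (monotone_partialSum hω) ht]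
  conv_rhs => rw [← ENat.natCast_toNat hωt.ne, Nat.cast_le]

/-! ### Laws of the partial sums under sub-independence. -/

section SubIndependent

variable {Ω : Type*} [MeasurableSpace Ω] {P : Measure Ω} [IsProbabilityMeasure P]
  {X : ℕ → Ω → ℝ}

/-- The only place where the product formula for characteristic functions is applied directly. -/
lemma map_partialSum_eq_convPower (hmeas : ∀ i, Measurable (X i))
    (hident : ∀ i, IdentDistrib (X i) (X 0) P P)
    (hsub : ∀ n : ℕ, SubIndependent P (Finset.range n) X) (n : ℕ) :
    P.map (partialSum X n) = convPower (P.map (X 0)) n := by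
  have := Measure.isProbabilityMeasure_map (hmeas 0).aemeasurable (μ := P)
  have := Measure.isProbabilityMeasure_map (measurable_partialSum hmeas n).aemeasurable (μ := P)
  refine Measure.ext_of_charFun (funext fun u => ?_)
  rw [charFun_convPower]
  refine (hsub n u).trans ?_
  simp [fun i => (hident i).map_eq]

lemma measure_partialSum_le (hmeas : ∀ i, Measurable (X i))
    (hident : ∀ i, IdentDistrib (X i) (X 0) P P)
    (hsub : ∀ n : ℕ, SubIndependent P (Finset.range n) X) (n : ℕ) (t : ℝ) :
    P {ω | partialSum X n ω ≤ t} = convPower (P.map (X 0)) n (Set.Iic t) := by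
  rw [← map_partialSum_eq_convPower hmeas hident hsub,
    Measure.map_apply (measurable_partialSum hmeas n) measurableSet_Iic]
  rfl

lemma renewalFunction_eq_renewalSum (hmeas : ∀ i, Measurable (X i))
    (hnonneg : ∀ i, ∀ᵐ ω ∂P, 0 ≤ X i ω)
    (hident : ∀ i, IdentDistrib (X i) (X 0) P P)
    (hsub : ∀ n : ℕ, SubIndependent P (Finset.range n) X) {t : ℝ} (ht : 0 ≤ t) :
    renewalFunction P X t = renewalSum (P.map (X 0)) t := by
  have hms (k : ℕ) : MeasurableSet {ω | partialSum X (k + 1) ω ≤ t} :=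
    measurableSet_le (measurable_partialSum hmeas _) measurable_const
  have : ∀ᵐ ω ∂P, (renewalCount X t ω : ℝ≥0∞) =
      ∑' k : ℕ, {ω | partialSum X (k + 1) ω ≤ t}.indicator 1 ω := by
    filter_upwards [ae_all_iff.2 hnonneg] with ω hω
    rw [ENat.toENNReal_eq_tsum_indicator]
    simp only [natCast_le_renewalCount_iff (monotone_partialSum hω) ht]
    rfl
  rw [renewalFunction, lintegral_congr_ae this,
    lintegral_tsum fun k => (measurable_one.indicator (hms k)).aemeasurable, renewalSum]
  refine tsum_congr fun k => ?_
  rw [lintegral_indicator_one (hms k), measure_partialSum_le hmeas hident hsub]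

end SubIndependent

/-! ### Convergence in distribution and the central limit theorem for the sums. -/

/-- Intervals `[a, b)` form a π-system containing small neighbourhoods of every point, and their
masses are differences of upper tails. Upper tails suit `N(t)`, whose events are `{N(t) ≥ n}`. -/
lemma ProbabilityMeasure.tendsto_of_tendsto_Ici {ι : Type*} {l : Filter ι}
    [l.IsCountablyGenerated] {μ : ι → ProbabilityMeasure ℝ} {ν : ProbabilityMeasure ℝ}
    (h : ∀ x, Tendsto (fun i => (μ i : Measure ℝ) (Set.Ici x)) l
      (𝓝 ((ν : Measure ℝ) (Set.Ici x)))) :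
    Tendsto μ l (𝓝 ν) := by
  refine (isPiSystem_Ico (id : ℝ → ℝ) id).tendsto_probabilityMeasure_of_tendsto_of_mem
    ?_ ?_ ?_
  · rintro s ⟨a, b, -, rfl⟩
    exact measurableSet_Ico
  · intro u hu x hx
    obtain ⟨ε, hε, hεu⟩ := Metric.isOpen_iff.1 hu x hx
    refine ⟨Set.Ico (x - ε / 2) (x + ε), ⟨x - ε / 2, x + ε, by simp only [id]; linarith, rfl⟩,
      Ico_mem_nhds (by linarith) (by linarith), fun y hy => hεu ?_⟩
    rw [Real.ball_eq_Ioo]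
    exact ⟨by linarith [hy.1], hy.2⟩
  · rintro s ⟨a, b, hab, rfl⟩
    simp only [id] at hab ⊢
    have hd (ρ : ProbabilityMeasure ℝ) : (ρ : Measure ℝ) (Set.Ico a b) =
        (ρ : Measure ℝ) (Set.Ici a) - (ρ : Measure ℝ) (Set.Ici b) := by
      rw [← measure_sdiff (Set.Ici_subset_Ici.2 hab.le) measurableSet_Ici.nullMeasurableSet
        (measure_ne_top _ _)]
      congr 1
      ext y
      simp
    rw [← ENNReal.tendsto_coe]
    simp only [ProbabilityMeasure.ennreal_coeFn_eq_coeFn_toMeasure, hd]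
    exact ENNReal.Tendsto.sub (h a) (h b) (Or.inl (measure_ne_top _ _))

lemma charFun_map_mul_add_comp {Ω : Type*} [MeasurableSpace Ω] {P : Measure Ω} {f : Ω → ℝ}
    (hf : AEMeasurable f P) (a b u : ℝ) :
    charFun (P.map fun ω => a * f ω + b) u =
      charFun (P.map f) (a * u) * Complex.exp (b * u * Complex.I) := by
  have : (P.map fun ω => a * f ω + b) = (P.map fun ω => a * f ω).map (· + b) := by
    rw [AEMeasurable.map_map_of_aemeasurable (by fun_prop) (by fun_prop)]
    rfl
  rw [this, charFun_map_add_const, charFun_map_mul_comp hf]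
  simp [mul_comm]

section CentralLimit

variable {Ω : Type*} [MeasurableSpace Ω] {P : Measure Ω} [IsProbabilityMeasure P]
  {X : ℕ → Ω → ℝ}

/-- The central limit theorem for sub-independent identically distributed random variables. -/
lemma tendstoInDistribution_partialSum (hmeas : ∀ i, Measurable (X i))
    (hident : ∀ i, IdentDistrib (X i) (X 0) P P)
    (hsub : ∀ n : ℕ, SubIndependent P (Finset.range n) X)
    (hL2 : MemLp (X 0) 2 P) (hvar : 0 < variance (X 0) P) :
    TendstoInDistribution
      (fun (n : ℕ) ω => (√n)⁻¹ * ((partialSum X n ω - n * P[X 0]) / √(variance (X 0) P)))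
      atTop (id : ℝ → ℝ) (fun _ => P) (gaussianReal 0 1) := by
  set m := P[X 0] with hm
  set σ := √(variance (X 0) P) with hσ
  have hσ0 : 0 < σ := Real.sqrt_pos.2 hvar
  have hS := measurable_partialSum hmeas
  have hX0 := hmeas 0
  have hint : Integrable (X 0) P := hL2.integrable (by norm_num)
  refine ⟨fun n => by fun_prop, aemeasurable_id, ?_⟩
  refine ProbabilityMeasure.tendsto_iff_tendsto_charFun.2 fun u => ?_
  -- As in the i.i.d. case, an `n`-th power of one characteristic function at `u/√n`.
  have hchar (n : ℕ) :
      charFun (P.map fun ω => (√n)⁻¹ * ((partialSum X n ω - n * m) / σ)) u =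
        charFun (P.map fun ω => (X 0 ω - m) / σ) ((√n)⁻¹ * u) ^ n := by
    have h1 : (fun ω => (√n)⁻¹ * ((partialSum X n ω - n * m) / σ)) =
        fun ω => ((√n)⁻¹ * σ⁻¹) * partialSum X n ω + -((√n)⁻¹ * (n * m) * σ⁻¹) := by
      ext ω; ring
    have h2 : (fun ω => (X 0 ω - m) / σ) = fun ω => σ⁻¹ * X 0 ω + -(m * σ⁻¹) := by
      ext ω; ring
    have := Measure.isProbabilityMeasure_map (hmeas 0).aemeasurable (μ := P)
    rw [h1, h2, charFun_map_mul_add_comp (by fun_prop), charFun_map_mul_add_comp (by fun_prop),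
      map_partialSum_eq_convPower hmeas hident hsub, charFun_convPower, mul_pow,
      ← Complex.exp_nat_mul]
    push_cast
    ring_nf
  simp only [ProbabilityMeasure.coe_mk, hchar, Measure.map_id, charFun_gaussianReal]
  have h0 : P[fun ω => (X 0 ω - m) / σ] = 0 := by
    rw [integral_div, integral_sub hint (by simp)]
    simp [hm]
  have h1 : P[(fun ω => (X 0 ω - m) / σ) ^ 2] = 1 := by
    simp only [Pi.pow_apply, div_pow]
    rw [integral_div, ← variance_eq_integral hX0.aemeasurable, Real.sq_sqrt hvar.le,
      div_self hvar.ne']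
  simpa [neg_div] using tendsto_charFun_inv_sqrt_mul_pow (by fun_prop) h0 h1 u

end CentralLimit

/-! ### Asymptotics of the index `⌈t/m + c√t⌉`. -/

section Asymptotics

variable {m : ℝ}

lemma tendsto_natCeil_div (hm : 0 < m) (c : ℝ) :
    Tendsto (fun t : ℝ => (⌈t / m + c * √t⌉₊ : ℝ) / t) atTop (𝓝 m⁻¹) := by
  have hlim (d : ℝ) : Tendsto (fun t : ℝ => m⁻¹ + c / √t + d / t) atTop (𝓝 m⁻¹) := by
    simpa using (((tendsto_const_nhds (x := c)).div_atTop Real.tendsto_sqrt_atTop).const_add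
      m⁻¹).add ((tendsto_const_nhds (x := d)).div_atTop tendsto_id)
  have hrw {t : ℝ} (ht : 0 < t) (d : ℝ) :
      m⁻¹ + c / √t + d / t = (t / m + c * √t + d) / t := by
    have : t = √t * √t := (Real.mul_self_sqrt ht.le).symm
    have h1 : c / √t = c * √t / t := by
      rw [div_eq_div_iff (by positivity) (by positivity)]
      rw [mul_assoc, ← this]
    rw [h1]
    field_simp
  refine tendsto_of_tendsto_of_tendsto_of_le_of_le' (hlim 0) (hlim 1) ?_ ?_
  · filter_upwards [eventually_gt_atTop 0] with t ht
    rw [hrw ht, add_zero]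
    gcongr
    exact Nat.le_ceil _
  -- The bound `⌈y⌉₊ < y + 1` needs `y ≥ 0`, which for `c < 0` holds only eventually.
  · filter_upwards [eventually_gt_atTop 0, (hlim 0).eventually_const_lt (inv_pos.2 hm)]
      with t ht h0
    rw [hrw ht] at h0 ⊢
    gcongr
    refine (Nat.ceil_lt_add_one ?_).le
    rw [add_zero] at h0
    exact ((div_pos_iff_of_pos_right ht).1 h0).le

lemma tendsto_natCeil_atTop (hm : 0 < m) (c : ℝ) :
    Tendsto (fun t : ℝ => ⌈t / m + c * √t⌉₊) atTop atTop := by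
  rw [← tendsto_natCast_atTop_iff (R := ℝ)]
  refine ((tendsto_natCeil_div hm c).pos_mul_atTop (inv_pos.2 hm) tendsto_id).congr' ?_
  filter_upwards [eventually_gt_atTop 0] with t ht
  exact div_mul_cancel₀ _ ht.ne'

/-- With `n` this index, `n m - t = c m √t + O(1)` while `√n ∼ √(t/m)`. -/
lemma tendsto_natCeil_mul_sub_div (hm : 0 < m) (c : ℝ) :
    Tendsto (fun t : ℝ => ((⌈t / m + c * √t⌉₊ : ℝ) * m - t) / √(⌈t / m + c * √t⌉₊ : ℝ)) atTop
      (𝓝 (c * m * √m)) := by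
  have hnum : Tendsto (fun t : ℝ => ((⌈t / m + c * √t⌉₊ : ℝ) * m - t) / √t) atTop
      (𝓝 (c * m)) := by
    have hlim : Tendsto (fun t : ℝ => c * m + m / √t) atTop (𝓝 (c * m)) := by
      simpa using ((tendsto_const_nhds (x := m)).div_atTop Real.tendsto_sqrt_atTop).const_add
        (c * m)
    refine tendsto_of_tendsto_of_tendsto_of_le_of_le' tendsto_const_nhds hlim ?_ ?_
    · filter_upwards [eventually_gt_atTop 0] with t ht
      rw [le_div_iff₀ (Real.sqrt_pos.2 ht)]
      have := mul_le_mul_of_nonneg_right (Nat.le_ceil (t / m + c * √t)) hm.le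
      rw [add_mul, div_mul_cancel₀ _ hm.ne'] at this
      linarith
    · filter_upwards [eventually_gt_atTop 0,
        (tendsto_natCeil_atTop hm c).eventually_gt_atTop 0] with t ht hpos
      have hs := Real.sqrt_pos.2 ht
      rw [div_le_iff₀ hs, add_mul, div_mul_cancel₀ _ hs.ne']
      have := mul_le_mul_of_nonneg_right
        (Nat.ceil_lt_add_one (Nat.ceil_pos.1 hpos).le).le hm.le
      rw [add_mul, add_mul, div_mul_cancel₀ _ hm.ne'] at this
      linarith
  have hden : Tendsto (fun t : ℝ => √((⌈t / m + c * √t⌉₊ : ℝ) / t)) atTop (𝓝 √m⁻¹) :=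
    (Real.continuous_sqrt.tendsto _).comp (tendsto_natCeil_div hm c)
  have := hnum.div hden (Real.sqrt_pos.2 (inv_pos.2 hm)).ne'
  rw [Real.sqrt_inv, div_inv_eq_mul] at this
  refine this.congr' ?_
  filter_upwards [eventually_gt_atTop 0] with t ht
  rw [Pi.div_apply, Real.sqrt_div (Nat.cast_nonneg _),
    div_div_div_cancel_right₀ (Real.sqrt_pos.2 ht).ne']

end Asymptotics

/-! ### Transfer of the normal limit to the counting process. -/

section CentralLimitCount

variable {Ω : Type*} [MeasurableSpace Ω] {P : Measure Ω} [IsProbabilityMeasure P]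
  {X : ℕ → Ω → ℝ}

lemma tendsto_measure_partialSum_natCeil_le (hmeas : ∀ i, Measurable (X i))
    (hident : ∀ i, IdentDistrib (X i) (X 0) P P)
    (hsub : ∀ n : ℕ, SubIndependent P (Finset.range n) X)
    (hL2 : MemLp (X 0) 2 P) (hvar : 0 < variance (X 0) P) (hm : 0 < P[X 0]) (c : ℝ) :
    Tendsto (fun t : ℝ => P {ω | partialSum X ⌈t / P[X 0] + c * √t⌉₊ ω ≤ t}) atTop
      (𝓝 (gaussianReal 0 1 (Set.Ici (c * P[X 0] * √P[X 0] / √(variance (X 0) P))))) := by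
  set m := P[X 0]
  set σ := √(variance (X 0) P)
  set x := c * m * √m / σ
  set n : ℝ → ℕ := fun t => ⌈t / m + c * √t⌉₊
  have hσ0 : 0 < σ := Real.sqrt_pos.2 hvar
  have hS := measurable_partialSum hmeas
  have hclt := tendstoInDistribution_partialSum hmeas hident hsub hL2 hvar
  have hclt' : TendstoInDistribution
      (fun (t : ℝ) ω => (√(n t))⁻¹ * ((partialSum X (n t) ω - n t * m) / σ))
      atTop (id : ℝ → ℝ) (fun _ => P) (gaussianReal 0 1) :=
    ⟨fun t => hclt.forall_aemeasurable (n t), hclt.aemeasurable_limit,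
      hclt.tendsto.comp (tendsto_natCeil_atTop hm c)⟩
  -- `S_n ≤ t` says that the standardized sum plus `d t` is at most `0`. As `d t → x`, Slutsky's
  -- lemma gives the limit law of a standard normal shifted by `x`.
  set d : ℝ → ℝ := fun t => (n t * m - t) / √(n t) / σ
  have hd : Tendsto d atTop (𝓝 x) := (tendsto_natCeil_mul_sub_div hm c).div_const σ
  have hdm : TendstoInMeasure P (fun t (_ : Ω) => d t) atTop (fun _ => x) := by
    intro ε hε
    refine tendsto_const_nhds.congr' ?_
    filter_upwards [(tendsto_iff_edist_tendsto_0.1 hd).eventually_lt_const hε] with t ht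
    simp [ht.not_ge]
  have hsl := hclt'.add_of_tendstoInMeasure_const hdm (fun _ => aemeasurable_const)
  have hfr : (gaussianReal 0 1).map (fun y => id y + x) (frontier (Set.Iic 0)) = 0 := by
    rw [frontier_Iic, Measure.map_apply (by fun_prop) (measurableSet_singleton _)]
    have : (fun y : ℝ => id y + x) ⁻¹' {0} = {-x} := by
      ext y
      simp [eq_neg_iff_add_eq_zero]
    have := nullSingletonClass_gaussianReal (μ := 0) (v := 1) one_ne_zero
    simp [*]
  have key := ProbabilityMeasure.tendsto_measure_of_null_frontier_of_tendsto' hsl.tendsto hfr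
  simp only [ProbabilityMeasure.coe_mk] at key
  -- Symmetry of the Gaussian turns the lower tail at `-x` into the upper tail at `x`.
  have hlim : (gaussianReal 0 1).map (fun y => id y + x) (Set.Iic 0) =
      gaussianReal 0 1 (Set.Ici x) := by
    have h1 : (gaussianReal 0 1).map (fun y : ℝ => -y) = gaussianReal 0 1 := by
      rw [gaussianReal_map_neg, neg_zero]
    rw [Measure.map_apply (by fun_prop) measurableSet_Iic]
    conv_rhs => rw [← h1, Measure.map_apply (by fun_prop) measurableSet_Ici]
    congr 1
    ext y
    simp [le_neg_iff_add_nonpos_right]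
  rw [hlim] at key
  refine key.congr' ?_
  filter_upwards [(tendsto_natCeil_atTop hm c).eventually_gt_atTop 0] with t hnt
  have hn0 : 0 < √(n t) := Real.sqrt_pos.2 (Nat.cast_pos.2 hnt)
  rw [Measure.map_apply_of_aemeasurable (hsl.forall_aemeasurable t) measurableSet_Iic]
  congr 1
  ext ω
  have : (√(n t))⁻¹ * ((partialSum X (n t) ω - n t * m) / σ) + d t =
      (partialSum X (n t) ω - t) / (√(n t) * σ) := by
    simp only [d]
    field_simp
    ring
  simp only [Set.mem_preimage, Pi.add_apply, Set.mem_Iic, this, Set.mem_ofPred_eq]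
  rw [div_le_iff₀ (by positivity), zero_mul, sub_nonpos]

lemma tendstoInDistribution_renewalCount (hmeas : ∀ i, Measurable (X i))
    (hnonneg : ∀ i, ∀ᵐ ω ∂P, 0 ≤ X i ω)
    (hident : ∀ i, IdentDistrib (X i) (X 0) P P)
    (hsub : ∀ n : ℕ, SubIndependent P (Finset.range n) X)
    (hfin : ∀ t, 0 ≤ t → renewalFunction P X t ≠ ⊤)
    (hL2 : MemLp (X 0) 2 P) (hvar : 0 < variance (X 0) P) (hm : 0 < P[X 0]) :
    TendstoInDistribution
      (fun (t : ℝ) (ω : Ω) => (((renewalCount X t ω).toNat : ℝ) - t / P[X 0]) /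
        (√(variance (X 0) P) * √(t / P[X 0] ^ 3)))
      atTop (id : ℝ → ℝ) (fun _ => P) (gaussianReal 0 1) := by
  set m := P[X 0]
  set σ := √(variance (X 0) P)
  have hσ0 : 0 < σ := Real.sqrt_pos.2 hvar
  have hN (t : ℝ) : Measurable fun ω => ((renewalCount X t ω).toNat : ℝ) :=
    (measurable_from_top (f := fun N : ℕ∞ => (N.toNat : ℝ))).comp (measurable_renewalCount hmeas t)
  have hZ (t : ℝ) : Measurable fun ω => (((renewalCount X t ω).toNat : ℝ) - t / m) /
        (σ * √(t / m ^ 3)) := ((hN t).sub_const _).div_const _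
  refine ⟨fun t => (hZ t).aemeasurable, aemeasurable_id, ?_⟩
  refine ProbabilityMeasure.tendsto_of_tendsto_Ici fun x => ?_
  simp only [ProbabilityMeasure.coe_mk, Measure.map_id]
  have hm3 : √(m ^ 3) = m * √m := by
    rw [show m ^ 3 = m ^ 2 * m by ring, Real.sqrt_mul (by positivity), Real.sqrt_sq hm.le]
  have hsm : 0 < √m := Real.sqrt_pos.2 hm
  -- With this `c`, the standardized count is at least `x` iff `N(t) ≥ t/m + c√t`, equivalently
  -- `N(t) ≥ ⌈t/m + c√t⌉` as `N(t)` is an integer.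
  have key := tendsto_measure_partialSum_natCeil_le hmeas hident hsub hL2 hvar hm
    (x * σ / √(m ^ 3))
  have hx : x * σ / √(m ^ 3) * m * √m / σ = x := by
    rw [hm3]
    field_simp
  change Tendsto _ _ (𝓝 (gaussianReal 0 1 (Set.Ici (x * σ / √(m ^ 3) * m * √m / σ)))) at key
  rw [hx] at key
  refine key.congr' ?_
  filter_upwards [eventually_gt_atTop 0] with t ht
  rw [Measure.map_apply (hZ t) measurableSet_Ici,
    ← measure_le_renewalCount hmeas hnonneg ht.le (hfin t ht.le)]
  congr 1
  ext ω
  have hpos : 0 < √(t / m ^ 3) := Real.sqrt_pos.2 (by positivity)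
  simp only [Set.mem_ofPred_eq, Set.mem_preimage, Set.mem_Ici]
  rw [Nat.ceil_le, le_div_iff₀ (by positivity), le_sub_iff_add_le', Real.sqrt_div ht.le]
  change t / m + _ ≤ _ ↔ _
  rw [div_mul_eq_mul_div, mul_div_assoc, mul_assoc]

end CentralLimitCount

/-! ### The main theorem. -/

theorem theorem6p5 {Ω : Type*} [MeasurableSpace Ω] (P : Measure Ω) [IsProbabilityMeasure P]
    (X : ℕ → Ω → ℝ)
    (hmeas : ∀ i, Measurable (X i))
    (hnonneg : ∀ i, ∀ᵐ ω ∂P, 0 ≤ X i ω)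
    (hident : ∀ i, IdentDistrib (X i) (X 0) P P)
    (hsub : ∀ n : ℕ, SubIndependent P (Finset.range n) X)
    (hF0 : cdf (P.map (X 0)) 0 < 1) :
    -- `U(t) = E N(t)` is finite and equals `∑_{k ≥ 1} F^{*k}(t)`
    (∀ t : ℝ, 0 ≤ t →
      renewalFunction P X t ≠ ⊤ ∧
      HasSum (fun k : ℕ => cdf (convPower (P.map (X 0)) (k + 1)) t)
        (renewalFunction P X t).toReal) ∧
    -- the renewal equation `U = F + U * F`
    (∀ t : ℝ, 0 ≤ t →
      renewalFunction P X t =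
        ENNReal.ofReal (cdf (P.map (X 0)) t) +
          stieltjesConv (renewalFunction P X) (P.map (X 0)) t) ∧
    -- `U(t) / t → 1 / μ` if `μ < ∞`
    (Integrable (X 0) P →
      Tendsto (fun t : ℝ => (renewalFunction P X t).toReal / t) atTop
        (𝓝 (1 / ∫ ω, X 0 ω ∂P))) ∧
    -- `U(t) / t → 0` if `μ = ∞`
    ((∫⁻ ω, ENNReal.ofReal (X 0 ω) ∂P) = ⊤ →
      Tendsto (fun t : ℝ => (renewalFunction P X t).toReal / t) atTop (𝓝 0)) ∧
    -- the central limit theorem for `N(t)`, which is almost surely finite as `U(t) < ∞`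
    (MemLp (X 0) 2 P → 0 < variance (X 0) P →
      TendstoInDistribution
        (fun (t : ℝ) (ω : Ω) =>
          (((renewalCount X t ω).toNat : ℝ) - t / ∫ ω', X 0 ω' ∂P) /
            (√(variance (X 0) P) * √(t / (∫ ω', X 0 ω' ∂P) ^ 3)))
        atTop (id : ℝ → ℝ) (fun _ => P) (gaussianReal 0 1)) := by
  set ν := P.map (X 0) with hν
  have hX0 := hmeas 0
  have : IsProbabilityMeasure ν := Measure.isProbabilityMeasure_map hX0.aemeasurable
  have hν0 : ∀ᵐ x ∂ν, 0 ≤ x :=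
    (ae_map_iff hX0.aemeasurable measurableSet_Ici).2 (hnonneg 0)
  have hpos : ν (Set.Ioi 0) ≠ 0 := by
    intro h0
    rw [cdf_eq_real, ← Set.compl_Ioi, probReal_compl_eq_one_sub measurableSet_Ioi,
      measureReal_def, h0] at hF0
    simp at hF0
  have hU {t : ℝ} (ht : 0 ≤ t) : renewalFunction P X t = renewalSum ν t :=
    renewalFunction_eq_renewalSum hmeas hnonneg hident hsub ht
  have hfin {t : ℝ} (ht : 0 ≤ t) : renewalFunction P X t ≠ ⊤ := by
    rw [hU ht]
    exact renewalSum_ne_top hν0 hpos ht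
  have hmean : ∫⁻ x, ENNReal.ofReal x ∂ν = ∫⁻ ω, ENNReal.ofReal (X 0 ω) ∂P :=
    lintegral_map (by fun_prop) hX0
  have hint : ∫ ω, X 0 ω ∂P = (∫⁻ x, ENNReal.ofReal x ∂ν).toReal := by
    rw [hmean, integral_eq_lintegral_of_nonneg_ae (hnonneg 0) hX0.aestronglyMeasurable]
  -- The inverse is taken in `ℝ≥0∞`, where `∞⁻¹ = 0`, so both cases of the limit are covered.
  have hlim : Tendsto (fun t : ℝ => (renewalFunction P X t).toReal / t) atTop
      (𝓝 (∫⁻ x, ENNReal.ofReal x ∂ν)⁻¹.toReal) := by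
    refine (tendsto_renewalSum_div hν0 hpos).congr' ?_
    filter_upwards [eventually_ge_atTop 0] with t ht
    rw [hU ht]
  refine ⟨fun t ht => ⟨hfin ht, ?_⟩, fun t ht => ?_, fun _ => ?_, fun htop => ?_,
    fun hL2 hvar => ?_⟩
  · have h1 := ENNReal.hasSum_toReal (by simpa only [renewalSum] using hU ht ▸ hfin ht)
    rw [← ENNReal.tsum_toReal_eq (fun k => measure_ne_top _ _)] at h1
    simp only [cdf_eq_real]
    rw [hU ht]
    exact h1
  · rw [hU ht, ofReal_cdf, renewalSum_eq_add_stieltjesConv hν0]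
    congr 1
    exact setLIntegral_congr_fun measurableSet_Icc fun x hx => (hU (sub_nonneg.2 hx.2)).symm
  · rwa [ENNReal.toReal_inv, ← hint, ← one_div] at hlim
  · simpa [hmean, htop] using hlim
  · refine tendstoInDistribution_renewalCount hmeas hnonneg hident hsub (fun t ht => hfin ht) hL2
      hvar ?_
    have hI : Integrable (X 0) P := hL2.integrable (by norm_num)
    -- The mean is positive: otherwise `X 0` would vanish almost surely, contradicting `F(0) < 1`.
    rw [integral_pos_iff_support_of_nonneg_ae (hnonneg 0) hI, pos_iff_ne_zero]
    intro h0
    refine hpos ?_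
    rw [hν, Measure.map_apply hX0 measurableSet_Ioi]
    refine measure_mono_null (fun ω hω => ?_) h0
    exact ne_of_gt hω
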